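/- Let $K$ be a field, let $P=K[x_1,\dots,x_n]$, and let $I\subset P$ be a zero-dimensional ideal, i.e. a proper ideal with $\dim_K(P/I)<\infty$. Let $\sigma$ be a term ordering on the set $\mathbb T^n$ of terms $x_1^{\alpha_1}\cdots x_n^{\alpha_n}$, let $\mathcal O=\mathcal O_\sigma(I)$ be the set of terms not contained in the leading term ideal $\mathrm{LT}_\sigma(I)$, let $\partial\mathcal O=(x_1\mathcal O\cup\dots\cup x_n\mathcal O)\setminus\mathcal O=\{b_1,\dots,b_\nu\}$ be its border, and let $\mathrm{BT}_{\mathcal O}=(b_1,\dots,b_\nu)$. Let $G=\{g_1,\dots,g_\nu\}$ be the $\mathcal O$-border basis of $I$: we have $g_j\in I$, $g_j\in b_j+\langle\mathcal O\rangle_K$ for $j=1,\dots,\nu$, and $P=I\oplus\langle\mathcal O\rangle_K$. For $W=(w_1,\dots,w_n)\in(\mathbb N_+)^n$, grade $P$ by $\deg_W(x_i)=w_i$. For $f\ne0$ let $\mathrm{DF}_W(f)$ be the homogeneous component of $f$ of highest $W$-degree, and let $\mathrm{DF}_W(I)=(\mathrm{DF}_W(f)\mid f\in I\setminus\{0\})$.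 A set of nonzero elements of $I$ is a Macaulay basis of $I$ with respect to $W$ if their degree forms generate $\mathrm{DF}_W(I)$. Let $\overline P=K[x_0,\dots,x_n]$ be graded by $\overline W=(1,w_1,\dots,w_n)$. For $f=\sum_u c_u u\in P$ with terms $u$ and $d=\deg_W(f)$ let $f^{\rm hom}=\sum_u c_u\,x_0^{d-\deg_W(u)}u$ (with $0^{\rm hom}=0$), and let $I^{\rm hom}=(f^{\rm hom}\mid f\in I)$. (a) There exist weights $W\in(\mathbb N_+)^n$ such that $b_j=\mathrm{DF}_W(g_j)$ for $j=1,\dots,\nu$ and $G$ is a Macaulay basis of $I$ with respect to $W$. (b) For all weights $W$ as in (a), we have $I^{\rm hom}=(g_1^{\rm hom},\dots,g_\nu^{\rm hom})$, and $\overline P/I^{\rm hom}$ is a graded free $K[x_0]$-module, where $\deg(x_0)=1$; that is, it is a graded module which has a $K[x_0]$-basis consisting of homogeneous elements. In particular, $I=(g_1,\dots,g_\nu)$, and for all $W$ as in (a), the canonical homomorphism $K[x_0]\to\overline P/I^{\rm hom}$ is flat. Its general fiber is isomorphic to $P/I$, i.e. $\overline P/(I^{\rm hom}+(x_0-c))\cong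 P/I$ as $K$-algebras for every $c\in K\setminus\{0\}$ (in particular for $c=1$), and its special fiber is $\overline P/(I^{\rm hom}+(x_0))\cong P/\mathrm{BT}_{\mathcal O}$ as $K$-algebras. -/

import Mathlib

noncomputable section

namespace BorderDeform

open MvPolynomial

variable {K : Type*} [Field K] {n : ℕ}

/- A term `x₁^α₁ ⋯ xₙ^αₙ` is represented by its exponent vector `α : Fin n →₀ ℕ`;
the corresponding polynomial is `monomial α 1`. -/

/-- A zero-dimensional ideal of `K[x₁, …, xₙ]`: a proper ideal whose residue class ring is a
finite dimensional `K`-vector space. -/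
def IsZeroDimensional (I : Ideal (MvPolynomial (Fin n) K)) : Prop :=
  I ≠ ⊤ ∧ Module.Finite K (MvPolynomial (Fin n) K ⧸ I)

/-- The leading term ideal `LT_σ(I)`, generated by the leading terms of the nonzero elements
of `I`. -/
def ltIdeal (σ : MonomialOrder (Fin n)) (I : Ideal (MvPolynomial (Fin n) K)) :
    Ideal (MvPolynomial (Fin n) K) :=
  Ideal.span {p | ∃ f ∈ I, f ≠ 0 ∧ p = monomial (σ.degree f) (1 : K)}

/-- `O_σ(I)`: the set of all terms which are not contained in `LT_σ(I)`. -/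
def orderIdealOf (σ : MonomialOrder (Fin n)) (I : Ideal (MvPolynomial (Fin n) K)) :
    Set (Fin n →₀ ℕ) :=
  {t | monomial t (1 : K) ∉ ltIdeal σ I}

/-- The border `∂O = (x₁O ∪ ⋯ ∪ xₙO) \ O`. -/
def border (O : Set (Fin n →₀ ℕ)) : Set (Fin n →₀ ℕ) :=
  {t | (∃ i : Fin n, ∃ s ∈ O, t = s + Finsupp.single i 1) ∧ t ∉ O}

variable (K) in
/-- The `K`-vector space `⟨O⟩_K` spanned by the terms in `O`. -/
def termSpan (O : Set (Fin n →₀ ℕ)) : Submodule K (MvPolynomial (Fin n) K) :=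
  Submodule.span K ((fun t => monomial t (1 : K)) '' O)

variable (K) in
/-- The border term ideal `BT_O`, generated by the terms in the border of `O`. -/
def borderTermIdeal (O : Set (Fin n →₀ ℕ)) : Ideal (MvPolynomial (Fin n) K) :=
  Ideal.span ((fun t => monomial t (1 : K)) '' border O)

/-- `G = (g_b)`, indexed by the terms `b` of the border of `O`, is an `O`-border prebasis of `I`:
each `g_b` lies in `I` and is of the form `b - ∑ aᵢ tᵢ` with `aᵢ ∈ K` and `tᵢ ∈ O`. -/
def IsBorderPrebasis (O : Set (Fin n →₀ ℕ)) (I : Ideal (MvPolynomial (Fin n) K))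
    (g : border O → MvPolynomial (Fin n) K) : Prop :=
  ∀ b : border O, g b ∈ I ∧ ∃ r ∈ termSpan K O, g b = monomial b.1 1 - r

/-- An `O`-border basis of `I`: a border prebasis of `I` such that `P = I ⊕ ⟨O⟩_K`. -/
def IsBorderBasis (O : Set (Fin n →₀ ℕ)) (I : Ideal (MvPolynomial (Fin n) K))
    (g : border O → MvPolynomial (Fin n) K) : Prop :=
  IsBorderPrebasis O I g ∧ IsCompl (I.restrictScalars K) (termSpan K O)

/-- The degree form `DF_W(f)`: the homogeneous component of `f` of highest `W`-degree. -/
def degreeForm (W : Fin n → ℕ) (f : MvPolynomial (Fin n) K) : MvPolynomial (Fin n) K :=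
  weightedHomogeneousComponent W (weightedTotalDegree W f) f

/-- The degree form ideal `DF_W(I)`. -/
def degreeFormIdeal (W : Fin n → ℕ) (I : Ideal (MvPolynomial (Fin n) K)) :
    Ideal (MvPolynomial (Fin n) K) :=
  Ideal.span {p | ∃ f ∈ I, f ≠ 0 ∧ p = degreeForm W f}

/-- `G` is a Macaulay basis of `I` with respect to the grading given by `W`: a set of nonzero
elements of `I` whose degree forms generate `DF_W(I)`. -/
def IsMacaulayBasis (W : Fin n → ℕ) (I : Ideal (MvPolynomial (Fin n) K))
    (G : Set (MvPolynomial (Fin n) K)) : Prop :=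
  (∀ f ∈ G, f ∈ I ∧ f ≠ 0) ∧ degreeFormIdeal W I = Ideal.span (degreeForm W '' G)

/-- The weights `(1, w₁, …, wₙ)` of `x₀, x₁, …, xₙ`. -/
def extWeight (W : Fin n → ℕ) : Fin (n + 1) → ℕ := Fin.cons 1 W

/-- The homogenization of `f` in `K[x₀, …, xₙ]`: each term `c u` of `f` is replaced by
`c x₀^(deg_W f - deg_W u) u`. No truncation occurs, as `deg_W u ≤ deg_W f`. -/
def homogenize (W : Fin n → ℕ) (f : MvPolynomial (Fin n) K) : MvPolynomial (Fin (n + 1)) K :=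
  ∑ u ∈ f.support,
    monomial (Finsupp.cons (weightedTotalDegree W f - Finsupp.weight W u) u) (coeff u f)

/-- The homogenization `I^hom`, generated by the homogenizations of the elements of `I`. -/
def homIdeal (W : Fin n → ℕ) (I : Ideal (MvPolynomial (Fin n) K)) :
    Ideal (MvPolynomial (Fin (n + 1)) K) :=
  Ideal.span (homogenize W '' (I : Set (MvPolynomial (Fin n) K)))

/-- The structure homomorphism `K[x₀] → K[x₀, …, xₙ] / J`. -/
def familyMap (J : Ideal (MvPolynomial (Fin (n + 1)) K)) :
    Polynomial K →ₐ[K] MvPolynomial (Fin (n + 1)) K ⧸ J :=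
  Polynomial.aeval (Ideal.Quotient.mk J (X 0))

/-- The image of the degree `d` part of `K[x₀, …, xₙ]`, graded by the given weights, in the
residue class ring modulo `J`. -/
def quotientPart (V : Fin (n + 1) → ℕ) (J : Ideal (MvPolynomial (Fin (n + 1)) K)) (d : ℕ) :
    Submodule K (MvPolynomial (Fin (n + 1)) K ⧸ J) :=
  (weightedHomogeneousSubmodule K V d).map (Ideal.Quotient.mkₐ K J).toLinearMap

/-- Let `φ : K[x₀] → A` be a homomorphism of `K`-algebras and let `𝒜 d`, for `d : ℕ`, be
`K`-subspaces of `A`. Then `A` is a graded free module over `K[x₀]`, where `deg x₀ = 1`: it is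
the direct sum of the `𝒜 d`, multiplication by `x₀` raises the degree by one, and there is a
`K[x₀]`-basis consisting of homogeneous elements. -/
def IsGradedFree {A : Type*} [CommRing A] [Algebra K A] (φ : Polynomial K →ₐ[K] A)
    (𝒜 : ℕ → Submodule K A) : Prop :=
  DirectSum.IsInternal 𝒜 ∧
  (∀ d, ∀ a ∈ 𝒜 d, φ Polynomial.X * a ∈ 𝒜 (d + 1)) ∧
  letI : Module (Polynomial K) A := Module.compHom A φ.toRingHom
  ∃ B : Set A, (∀ b ∈ B, ∃ d, b ∈ 𝒜 d) ∧
    LinearIndepOn (Polynomial K) id B ∧ Submodule.span (Polynomial K) B = ⊤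

end BorderDeform

end

/-!
For every term `u` outside `O`, the border basis rewrites `u = s b` as `s (b - g_b)`. The leading
term of `g_b ∈ I` lies outside `O`, so it is `b`, the only such term of `g_b`. Hence all terms of
`b - g_b` are `σ`-smaller than `b`, and by Gordan's theorem (`exists_rat_weight_of_add_closed`)
these finitely many comparisons are induced by a weight vector `W`. This makes `b` the degree form of `g_b` (`IsBorderPrebasis.exists_weight`).

All the remaining assertions follow from the single fact `DF_W(g_b) = b`. Since rewriting then
strictly lowers the weighted degree, it terminates, and it lifts to the homogenizations:
modulo the ideal of the `g_b^hom`, each `u` is congruent to a combination of elements `x₀^k t` with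
`t ∈ O`, where `k > 0` if `u ∉ O` (`IsBorderPrebasis.exists_reduction`). Together with
`I ∩ ⟨O⟩_K = 0` this shows that the `g_b^hom` generate `I^hom`, that the `g_b` generate `I`, that no
term of `O` occurs in a degree form of an element of `I`, whence the Macaulay basis property, and
that the terms of `O` span `K[x₀, …, xₙ] / I^hom` over `K[x₀]`.

These terms are independent since the substitution `x₀ = T`, `xᵢ = T^wᵢ xᵢ` sends `f^hom` to
`T^d f`: a relation becomes a polynomial in `T` with coefficients in `I ∩ ⟨O⟩_K`. Homogeneity of
`I^hom` provides the grading, and freeness gives flatness. Specializing `T = c ≠ 0` identifies the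
general fiber with `P / I`; setting `x₀ = 0` sends `f^hom` to `DF_W(f)` and identifies the special
fiber with `P / BT_O`.
-/

/-! ### Weight vectors approximating a term ordering -/

/-- Gordan's theorem for a finite set `V` of integer vectors inside an additively closed set that
avoids `0`, proved by Fourier–Motzkin elimination of the first coordinate. -/
theorem exists_rat_weight_of_add_closed {n : ℕ} (P : (Fin n → ℤ) → Prop)
    (hadd : ∀ v w, P v → P w → P (v + w)) (h0 : ¬ P 0) (V : Finset (Fin n → ℤ))
    (hV : ∀ v ∈ V, P v) : ∃ W : Fin n → ℚ, ∀ v ∈ V, 0 < ∑ i, W i * v i := by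
  induction n with
  | zero =>
    refine ⟨0, fun v hv => (h0 ?_).elim⟩
    rw [Subsingleton.elim 0 v]
    exact hV v hv
  | succ n ih =>
    classical
    have hsmul : ∀ (k : ℕ) v, P v → P ((k + 1) • v) := by
      intro k v hv
      induction k with
      | zero => simpa using hv
      | succ k ihk => rw [succ_nsmul]; exact hadd _ _ ihk hv
    have hzsmul : ∀ (k : ℤ) v, 0 < k → P v → P (k • v) := by
      intro k v hk hv
      obtain ⟨m, rfl⟩ : ∃ m : ℕ, k = (m + 1 : ℕ) := ⟨(k - 1).toNat, by omega⟩
      rw [natCast_zsmul]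
      exact hsmul m v hv
    -- the positive combination of `p` and `q` in which the first coordinate cancels
    let comb : (Fin (n + 1) → ℤ) → (Fin (n + 1) → ℤ) → Fin n → ℤ :=
      fun p q => Fin.tail ((-q 0) • p + p 0 • q)
    obtain ⟨W, hW⟩ := ih (fun v => P (Fin.cons 0 v))
      (fun v w hv hw => by
        have : (Fin.cons 0 (v + w) : Fin (n + 1) → ℤ) = Fin.cons 0 v + Fin.cons 0 w := by
          ext i; refine Fin.cases ?_ (fun i => ?_) i <;> simp
        rw [this]
        exact hadd _ _ hv hw)
      (fun h => h0 (by
        have : (Fin.cons 0 (0 : Fin n → ℤ) : Fin (n + 1) → ℤ) = 0 := by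
          ext i; refine Fin.cases ?_ (fun i => ?_) i <;> simp
        rwa [this] at h))
      ((V.filter (fun v => v 0 = 0)).image Fin.tail ∪
        ((V.filter (fun v => 0 < v 0)) ×ˢ (V.filter (fun v => v 0 < 0))).image
          (fun pq => comb pq.1 pq.2))
      (fun v hv => by
        simp only [Finset.mem_union, Finset.mem_image, Finset.mem_filter, Finset.mem_product,
          Prod.exists] at hv
        rcases hv with ⟨p, ⟨hp, hp0⟩, rfl⟩ | ⟨p, q, ⟨⟨hp, hp0⟩, hq, hq0⟩, rfl⟩
        · have : (Fin.cons 0 (Fin.tail p) : Fin (n + 1) → ℤ) = p := by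
            rw [← hp0, Fin.cons_self_tail]
          rw [this]
          exact hV p hp
        · have h : ((-q 0) • p + p 0 • q) 0 = 0 := by simp; ring
          have : (Fin.cons 0 (comb p q) : Fin (n + 1) → ℤ) = (-q 0) • p + p 0 • q := by
            rw [← h, Fin.cons_self_tail]
          rw [this]
          exact hadd _ _ (hzsmul _ _ (by omega) (hV p hp)) (hzsmul _ _ hp0 (hV q hq)))
    -- the bounds on the first weight coming from the vectors with nonzero first coordinate
    let β : (Fin (n + 1) → ℤ) → ℚ := fun v => -(∑ i : Fin n, W i * v i.succ) / v 0
    obtain ⟨w, hw1, hw2⟩ := Order.exists_between_finsets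
      ((V.filter (fun v => 0 < v 0)).image β) ((V.filter (fun v => v 0 < 0)).image β) (by
        simp only [Finset.mem_image, Finset.mem_filter]
        rintro _ ⟨p, ⟨hp, hp0⟩, rfl⟩ _ ⟨q, ⟨hq, hq0⟩, rfl⟩
        have h := hW (comb p q) (Finset.mem_union_right _ (Finset.mem_image.2
          ⟨(p, q), by simp [hp, hp0, hq, hq0], rfl⟩))
        have e : ∑ i, W i * ((comb p q i : ℤ) : ℚ) =
            (-(q 0 : ℚ)) * (∑ i : Fin n, W i * p i.succ) +
              p 0 * (∑ i : Fin n, W i * q i.succ) := by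
          rw [Finset.mul_sum, Finset.mul_sum, ← Finset.sum_add_distrib]
          refine Finset.sum_congr rfl fun i _ => ?_
          simp [comb, Fin.tail]
          ring
        rw [e] at h
        have hp' : (0 : ℚ) < p 0 := by exact_mod_cast hp0
        have hq' : (q 0 : ℚ) < 0 := by exact_mod_cast hq0
        simp only [β]
        rw [div_lt_iff₀ hp', div_mul_eq_mul_div, lt_div_iff_of_neg hq']
        linarith)
    refine ⟨Fin.cons w W, fun v hv => ?_⟩
    rw [Fin.sum_univ_succ]
    simp only [Fin.cons_zero, Fin.cons_succ]
    rcases lt_trichotomy (v 0) 0 with h | h | h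
    · have := hw2 _ (Finset.mem_image_of_mem β (Finset.mem_filter.2 ⟨hv, h⟩))
      have h' : (v 0 : ℚ) < 0 := by exact_mod_cast h
      rw [lt_div_iff_of_neg h'] at this
      linarith
    · have := hW (Fin.tail v) (Finset.mem_union_left _
        (Finset.mem_image_of_mem _ (Finset.mem_filter.2 ⟨hv, h⟩)))
      simpa [h, Fin.tail] using this
    · have := hw1 _ (Finset.mem_image_of_mem β (Finset.mem_filter.2 ⟨hv, h⟩))
      have h' : (0 : ℚ) < v 0 := by exact_mod_cast h
      rw [div_lt_iff₀ h'] at this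
      linarith

/-- Finitely many strict comparisons of a term ordering are induced by positive integral
weights. -/
theorem MonomialOrder.exists_weight_lt {n : ℕ} (σ : MonomialOrder (Fin n))
    (S : Finset ((Fin n →₀ ℕ) × (Fin n →₀ ℕ)))
    (hS : ∀ p ∈ S, σ.toSyn p.1 < σ.toSyn p.2) :
    ∃ W : Fin n → ℕ, (∀ i, 0 < W i) ∧
      ∀ p ∈ S, Finsupp.weight W p.1 < Finsupp.weight W p.2 := by
  classical
  let vec : (Fin n →₀ ℕ) × (Fin n →₀ ℕ) → Fin n → ℤ := fun p i => (p.2 i : ℤ) - p.1 i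
  -- adjoining the comparisons `1 < xᵢ` makes the weights positive
  let S' := S ∪ Finset.univ.image fun i : Fin n => ((0 : Fin n →₀ ℕ), Finsupp.single i 1)
  have hS' : ∀ p ∈ S', σ.toSyn p.1 < σ.toSyn p.2 := by
    intro p hp
    rcases Finset.mem_union.1 hp with hp | hp
    · exact hS p hp
    · obtain ⟨i, -, rfl⟩ := Finset.mem_image.1 hp
      rw [map_zero, σ.toSyn_lt_iff_ne_zero, Ne, σ.toSyn_eq_zero_iff]
      simp
  obtain ⟨W, hW⟩ := exists_rat_weight_of_add_closed
    (fun v => ∃ p, σ.toSyn p.1 < σ.toSyn p.2 ∧ v = vec p)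
    (by
      rintro _ _ ⟨p, hp, rfl⟩ ⟨q, hq, rfl⟩
      refine ⟨p + q, ?_, ?_⟩
      · simpa using add_lt_add hp hq
      · ext i
        simp [vec]
        ring)
    (by
      rintro ⟨p, hp, h⟩
      have : p.1 = p.2 := by
        ext i
        have := congrFun h i
        simp only [Pi.zero_apply, vec] at this
        omega
      rw [this] at hp
      exact lt_irrefl _ hp)
    (S'.image vec)
    (by
      intro v hv
      obtain ⟨p, hp, rfl⟩ := Finset.mem_image.1 hv
      exact ⟨p, hS' p hp, rfl⟩)
  have hpos : ∀ i, 0 < W i := by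
    intro i
    have := hW _ (Finset.mem_image_of_mem vec (Finset.mem_union_right S
      (Finset.mem_image_of_mem (fun i : Fin n => ((0 : Fin n →₀ ℕ), Finsupp.single i 1))
        (Finset.mem_univ i))))
    simpa [vec, Finsupp.single_apply] using this
  -- a common denominator of the weights
  let N : ℕ := ∏ i, (W i).den
  have hN : 0 < N := Finset.prod_pos fun i _ => (W i).den_pos
  have hint : ∀ i, ∃ m : ℕ, (m : ℚ) = N * W i := by
    intro i
    obtain ⟨k, hk⟩ : (W i).den ∣ N := Finset.dvd_prod_of_mem _ (Finset.mem_univ i)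
    refine ⟨k * (W i).num.toNat, ?_⟩
    have h1 : (((W i).num.toNat : ℤ) : ℚ) = (W i).num := by
      rw [Int.toNat_of_nonneg (Rat.num_pos.2 (hpos i)).le]
    have h2 : (W i).den * W i = (W i).num := Rat.den_mul_eq_num _
    push_cast at h1 ⊢
    rw [h1, hk, ← h2]
    push_cast
    ring
  choose w hw using hint
  have hN' : (0 : ℚ) < N := by exact_mod_cast hN
  refine ⟨w, fun i => ?_, fun p hp => ?_⟩
  · have : (0 : ℚ) < w i := by rw [hw]; exact mul_pos hN' (hpos i)
    exact_mod_cast this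
  · have h := mul_pos hN' (hW _ (Finset.mem_image_of_mem vec (Finset.mem_union_left _ hp)))
    rw [Finsupp.weight_eq_sum, Finsupp.weight_eq_sum]
    have : ((∑ i, p.1 i • w i : ℕ) : ℚ) < ((∑ i, p.2 i • w i : ℕ) : ℚ) := by
      have e : (N : ℚ) * ∑ i, W i * (vec p i : ℤ) =
          ((∑ i, p.2 i • w i : ℕ) : ℚ) - ((∑ i, p.1 i • w i : ℕ) : ℚ) := by
        push_cast
        rw [Finset.mul_sum, ← Finset.sum_sub_distrib]
        refine Finset.sum_congr rfl fun i _ => ?_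
        simp [vec, hw]
        ring
      rwa [e, sub_pos] at h
    exact_mod_cast this

namespace BorderDeform

open MvPolynomial

section BorderBases

/-! ### Order ideals and border bases -/

variable {K : Type*} [Field K] {n : ℕ}

theorem termSpan_eq_restrictSupport (O : Set (Fin n →₀ ℕ)) :
    termSpan K O = restrictSupport K O :=
  (restrictSupport_eq_span K O).symm

theorem mem_termSpan {O : Set (Fin n →₀ ℕ)} {f : MvPolynomial (Fin n) K} :
    f ∈ termSpan K O ↔ ∀ t, coeff t f ≠ 0 → t ∈ O := by
  rw [termSpan_eq_restrictSupport, mem_restrictSupport_iff]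
  simp [Set.subset_def]

theorem termSpan_mono {O O' : Set (Fin n →₀ ℕ)} (h : O ⊆ O') : termSpan K O ≤ termSpan K O' :=
  Submodule.span_mono (Set.image_mono h)

theorem isLowerSet_orderIdealOf (σ : MonomialOrder (Fin n))
    (I : Ideal (MvPolynomial (Fin n) K)) : IsLowerSet (orderIdealOf σ I) := by
  intro a b hba ha hb
  refine ha ?_
  obtain ⟨c, rfl⟩ := exists_add_of_le hba
  have : monomial (b + c) (1 : K) = monomial c 1 * monomial b 1 := by
    rw [monomial_mul, mul_one, add_comm]
  rw [this]
  exact Ideal.mul_mem_left _ _ hb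

/-- A nonempty order ideal contains the term `1`, so the border divides every term outside. -/
theorem exists_border_le {O : Set (Fin n →₀ ℕ)} (hO : IsLowerSet O) (hne : O.Nonempty)
    {u : Fin n →₀ ℕ} (hu : u ∉ O) : ∃ b ∈ border O, b ≤ u := by
  have h0 : (0 : Fin n →₀ ℕ) ∈ O := by
    obtain ⟨t, ht⟩ := hne
    exact hO (zero_le (a := t)) ht
  induction hd : u.degree generalizing u with
  | zero =>
    rw [Finsupp.degree_eq_zero_iff] at hd
    exact (hu (hd ▸ h0)).elim
  | succ d ih =>
    have hne : u ≠ 0 := by rintro rfl; exact hu h0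
    obtain ⟨i, hi⟩ := Finsupp.ne_iff.1 hne
    have hi' : Finsupp.single i 1 ≤ u := by
      rw [Finsupp.single_le_iff]
      exact Nat.one_le_iff_ne_zero.2 hi
    obtain ⟨v, rfl⟩ := exists_add_of_le hi'
    by_cases hv : v ∈ O
    · exact ⟨_, ⟨⟨i, v, hv, add_comm _ _⟩, hu⟩, le_rfl⟩
    · have : v.degree = d := by
        rw [map_add, Finsupp.degree_single] at hd
        omega
      obtain ⟨b, hb, hbv⟩ := ih hv this
      exact ⟨b, hb, hbv.trans le_add_self⟩

theorem nonempty_of_isCompl {O : Set (Fin n →₀ ℕ)} {I : Ideal (MvPolynomial (Fin n) K)}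
    (hI : I ≠ ⊤) (h : IsCompl (I.restrictScalars K) (termSpan K O)) : O.Nonempty := by
  rw [Set.nonempty_iff_ne_empty]
  rintro rfl
  have := h.sup_eq_top
  rw [termSpan, Set.image_empty, Submodule.span_empty, sup_bot_eq,
    Submodule.restrictScalars_eq_top_iff] at this
  exact hI this

/-- The terms of `O` are linearly independent modulo `I`, so there are finitely many. -/
theorem finite_of_disjoint {O : Set (Fin n →₀ ℕ)} {I : Ideal (MvPolynomial (Fin n) K)}
    [Module.Finite K (MvPolynomial (Fin n) K ⧸ I)]
    (h : Disjoint (I.restrictScalars K) (termSpan K O)) : O.Finite := by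
  have hli : LinearIndependent K fun t : O => monomial t.1 (1 : K) := by
    have := (basisMonomials (Fin n) K).linearIndependent
    rw [coe_basisMonomials] at this
    exact this.comp (fun t : O => t.1) Subtype.val_injective
  have := hli.map (f := (Ideal.Quotient.mkₐ K I).toLinearMap) (by
    rw [show Set.range (fun t : O => monomial t.1 (1 : K)) = (fun t => monomial t 1) '' O by
      ext; simp]
    refine h.symm.mono_right ?_
    intro f hf
    simpa [Ideal.Quotient.eq_zero_iff_mem] using hf)
  have := this.finite
  exact Set.toFinite O

theorem finite_border {O : Set (Fin n →₀ ℕ)} (hO : O.Finite) : (border O).Finite := by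
  refine ((Set.finite_univ (α := Fin n)).image2 (fun i s => s + Finsupp.single i 1) hO).subset ?_
  rintro _ ⟨⟨i, s, hs, rfl⟩, -⟩
  exact ⟨i, Set.mem_univ _, s, hs, rfl⟩

variable {O : Set (Fin n →₀ ℕ)} {I : Ideal (MvPolynomial (Fin n) K)}
  {g : border O → MvPolynomial (Fin n) K}

theorem IsBorderPrebasis.coeff_self (hg : IsBorderPrebasis O I g) (b : border O) :
    coeff b.1 (g b) = 1 := by
  obtain ⟨-, r, hr, h⟩ := hg b
  have : coeff b.1 r = 0 := by
    by_contra h'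
    exact b.2.2 (mem_termSpan.1 hr _ h')
  rw [h, coeff_sub, this, coeff_monomial, if_pos rfl, sub_zero]

theorem IsBorderPrebasis.mem_of_coeff_ne_zero (hg : IsBorderPrebasis O I g) (b : border O)
    {t : Fin n →₀ ℕ} (ht : coeff t (g b) ≠ 0) (htb : t ≠ b.1) : t ∈ O := by
  obtain ⟨-, r, hr, h⟩ := hg b
  refine mem_termSpan.1 hr t fun h' => ht ?_
  rw [h, coeff_sub, h', coeff_monomial, if_neg htb.symm, sub_zero]

theorem IsBorderPrebasis.ne_zero (hg : IsBorderPrebasis O I g) (b : border O) : g b ≠ 0 := by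
  intro h
  simpa [h] using hg.coeff_self b

/-- The leading term of `g_b` with respect to `σ` is `b`: it lies outside `O_σ(I)`. -/
theorem IsBorderPrebasis.toSyn_lt {σ : MonomialOrder (Fin n)}
    {g : border (orderIdealOf σ I) → MvPolynomial (Fin n) K}
    (hg : IsBorderPrebasis (orderIdealOf σ I) I g) (b : border (orderIdealOf σ I))
    {t : Fin n →₀ ℕ} (ht : coeff t (g b) ≠ 0) (htb : t ≠ b.1) :
    σ.toSyn t < σ.toSyn b.1 := by
  have hdeg : σ.degree (g b) = b.1 := by
    by_contra hne
    refine hg.mem_of_coeff_ne_zero b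
      (mem_support_iff.1 (σ.degree_mem_support (hg.ne_zero b))) hne ?_
    exact Ideal.subset_span ⟨g b, (hg b).1, hg.ne_zero b, rfl⟩
  refine lt_of_le_of_ne ?_ (fun h => htb (σ.toSyn.injective h))
  rw [← hdeg]
  exact σ.le_degree (mem_support_iff.2 ht)

/-- The condition `DF_W(g_b) = b` says that `b` is the unique term of `g_b` of maximal weight. -/
theorem degreeForm_eq_monomial_iff (W : Fin n → ℕ) {f : MvPolynomial (Fin n) K}
    {b : Fin n →₀ ℕ} (hb : coeff b f = 1) :
    degreeForm W f = monomial b 1 ↔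
      ∀ t, coeff t f ≠ 0 → t ≠ b → Finsupp.weight W t < Finsupp.weight W b := by
  classical
  have hbs : b ∈ f.support := mem_support_iff.2 (by simp [hb])
  constructor
  · intro h
    have hwt : Finsupp.weight W b = weightedTotalDegree W f := by
      by_contra hne
      have := congrArg (coeff b) h
      rw [degreeForm, coeff_weightedHomogeneousComponent, if_neg hne] at this
      simp at this
    intro t ht htb
    rw [hwt]
    refine lt_of_le_of_ne (le_weightedTotalDegree W (mem_support_iff.2 ht)) fun heq => ht ?_
    have := congrArg (coeff t) h
    rwa [degreeForm, coeff_weightedHomogeneousComponent, if_pos heq, coeff_monomial,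
      if_neg htb.symm] at this
  · intro h
    have hwt : weightedTotalDegree W f = Finsupp.weight W b := by
      refine le_antisymm (Finset.sup_le fun t ht => ?_) (le_weightedTotalDegree W hbs)
      rcases eq_or_ne t b with rfl | hne
      · exact le_rfl
      · exact (h t (mem_support_iff.1 ht) hne).le
    ext t
    rw [degreeForm, coeff_weightedHomogeneousComponent, hwt, coeff_monomial]
    rcases eq_or_ne t b with rfl | hne
    · simp [hb]
    · rw [if_neg hne.symm]
      split_ifs with heq
      · by_contra h'
        exact (h t h' hne).ne heq
      · rfl

theorem IsBorderPrebasis.exists_weight {σ : MonomialOrder (Fin n)}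
    {g : border (orderIdealOf σ I) → MvPolynomial (Fin n) K}
    (hg : IsBorderPrebasis (orderIdealOf σ I) I g) (hO : (orderIdealOf σ I).Finite) :
    ∃ W : Fin n → ℕ, (∀ i, 0 < W i) ∧ ∀ b, degreeForm W (g b) = monomial b.1 1 := by
  classical
  have : Fintype (border (orderIdealOf σ I)) := (finite_border hO).fintype
  obtain ⟨W, hW, h⟩ := σ.exists_weight_lt
    (Finset.univ.biUnion fun b => ((g b).support.erase b.1).image fun t => (t, b.1)) (by
      simp only [Finset.mem_biUnion, Finset.mem_univ, true_and, Finset.mem_image,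
        Finset.mem_erase, mem_support_iff]
      rintro _ ⟨b, t, ⟨htb, ht⟩, rfl⟩
      exact hg.toSyn_lt b ht htb)
  refine ⟨W, hW, fun b => (degreeForm_eq_monomial_iff W (hg.coeff_self b)).2 fun t ht htb => ?_⟩
  refine h (t, b.1) (Finset.mem_biUnion.2 ⟨b, Finset.mem_univ _, ?_⟩)
  exact Finset.mem_image_of_mem _ (Finset.mem_erase.2 ⟨htb, mem_support_iff.2 ht⟩)

end BorderBases

/-! ### Homogenization in a fixed degree -/

section Homogenization

variable {K : Type*} [Field K] {n : ℕ}

/-- The `K`-linear homogenization in degree `d`: a term `u` is sent to `x₀^(d - deg_W u) u`. It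
is meaningful on polynomials of weighted degree at most `d`; beyond that the subtraction
truncates. -/
noncomputable def homogenizeAt (W : Fin n → ℕ) (d : ℕ) :
    MvPolynomial (Fin n) K →ₗ[K] MvPolynomial (Fin (n + 1)) K :=
  (basisMonomials (Fin n) K).constr K fun u =>
    monomial (Finsupp.cons (d - Finsupp.weight W u) u) 1

theorem homogenizeAt_monomial (W : Fin n → ℕ) (d : ℕ) (u : Fin n →₀ ℕ) (a : K) :
    homogenizeAt W d (monomial u a) =
      monomial (Finsupp.cons (d - Finsupp.weight W u) u) a := by
  have h : monomial u a = a • monomial u (1 : K) := by rw [smul_monomial, smul_eq_mul, mul_one]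
  have h1 : homogenizeAt W d (monomial u (1 : K)) =
      monomial (Finsupp.cons (d - Finsupp.weight W u) u) 1 := by
    have := (basisMonomials (Fin n) K).constr_basis K
      (fun u => monomial (Finsupp.cons (d - Finsupp.weight W u) u) (1 : K)) u
    rwa [coe_basisMonomials] at this
  rw [h, map_smul, h1, smul_monomial, smul_eq_mul, mul_one]

theorem homogenizeAt_apply (W : Fin n → ℕ) (d : ℕ) (f : MvPolynomial (Fin n) K) :
    homogenizeAt W d f =
      ∑ u ∈ f.support, monomial (Finsupp.cons (d - Finsupp.weight W u) u) (coeff u f) := by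
  conv_lhs => rw [f.as_sum]
  simp_rw [map_sum, homogenizeAt_monomial]

theorem homogenize_eq_homogenizeAt (W : Fin n → ℕ) (f : MvPolynomial (Fin n) K) :
    homogenize W f = homogenizeAt W (weightedTotalDegree W f) f :=
  (homogenizeAt_apply W _ f).symm

theorem weight_cons (W : Fin n → ℕ) (k : ℕ) (u : Fin n →₀ ℕ) :
    Finsupp.weight (extWeight W) (Finsupp.cons k u) = k + Finsupp.weight W u := by
  rw [Finsupp.weight_eq_sum, Finsupp.weight_eq_sum, Fin.sum_univ_succ]
  simp [extWeight]

theorem homogenizeAt_mem (W : Fin n → ℕ) {d : ℕ} {f : MvPolynomial (Fin n) K}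
    (hf : ∀ u, coeff u f ≠ 0 → Finsupp.weight W u ≤ d) :
    IsWeightedHomogeneous (extWeight W) (homogenizeAt W d f) d := by
  rw [homogenizeAt_apply, ← mem_weightedHomogeneousSubmodule]
  refine Submodule.sum_mem _ fun u hu => ?_
  rw [mem_weightedHomogeneousSubmodule]
  refine isWeightedHomogeneous_monomial _ _ _ ?_
  rw [weight_cons]
  exact Nat.sub_add_cancel (hf u (mem_support_iff.1 hu))

theorem weight_le_of_coeff_ne_zero (W : Fin n → ℕ) (f : MvPolynomial (Fin n) K)
    (u : Fin n →₀ ℕ) (hu : coeff u f ≠ 0) :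
    Finsupp.weight W u ≤ weightedTotalDegree W f :=
  le_weightedTotalDegree W (mem_support_iff.2 hu)

theorem isHomogeneous_homIdeal (W : Fin n → ℕ) (I : Ideal (MvPolynomial (Fin n) K)) :
    letI := weightedGradedAlgebra K (extWeight W)
    (homIdeal W I).IsHomogeneous (weightedHomogeneousSubmodule K (extWeight W)) := by
  let := weightedGradedAlgebra K (extWeight W)
  refine Ideal.homogeneous_span _ _ ?_
  rintro _ ⟨f, -, rfl⟩
  refine ⟨weightedTotalDegree W f, ?_⟩
  rw [homogenize_eq_homogenizeAt]
  exact homogenizeAt_mem W (weight_le_of_coeff_ne_zero W f)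

theorem aeval_cons_monomial {A : Type*} [CommRing A] [Algebra K A] (y : Fin (n + 1) → A) (k : ℕ)
    (u : Fin n →₀ ℕ) (a : K) :
    aeval y (monomial (Finsupp.cons k u) a) =
      y 0 ^ k * aeval (fun i : Fin n => y i.succ) (monomial u a) := by
  rw [aeval_monomial, aeval_monomial, Finsupp.prod_fintype _ _ (fun _ => pow_zero _),
    Finsupp.prod_fintype _ _ (fun _ => pow_zero _), Fin.prod_univ_succ]
  simp only [Finsupp.cons_zero, Finsupp.cons_succ]
  ring

theorem aeval_weighted_monomial {A : Type*} [CommRing A] [Algebra K A] (W : Fin n → ℕ) (T : A)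
    (y : Fin n → A) (u : Fin n →₀ ℕ) (a : K) :
    aeval (fun i => T ^ W i * y i) (monomial u a) =
      T ^ Finsupp.weight W u * aeval y (monomial u a) := by
  rw [aeval_monomial, aeval_monomial, Finsupp.prod_fintype _ _ (fun _ => pow_zero _),
    Finsupp.prod_fintype _ _ (fun _ => pow_zero _), Finsupp.weight_eq_sum,
    ← Finset.prod_pow_eq_pow_sum]
  simp_rw [mul_pow, Finset.prod_mul_distrib, smul_eq_mul, ← pow_mul, mul_comm (W _)]
  ring

/-- Substituting `x₀ = T` and `xᵢ = T^wᵢ yᵢ` in a homogenization of degree `d` yields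
`T^d f(y)`. -/
theorem aeval_homogenizeAt {A : Type*} [CommRing A] [Algebra K A] (W : Fin n → ℕ) {d : ℕ}
    {f : MvPolynomial (Fin n) K} (hf : ∀ u, coeff u f ≠ 0 → Finsupp.weight W u ≤ d)
    (z : Fin (n + 1) → A) (y : Fin n → A) (hz : ∀ i : Fin n, z i.succ = z 0 ^ W i * y i) :
    aeval z (homogenizeAt W d f) = z 0 ^ d * aeval y f := by
  conv_rhs => rw [f.as_sum]
  rw [homogenizeAt_apply, map_sum, map_sum, Finset.mul_sum]
  refine Finset.sum_congr rfl fun u hu => ?_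
  simp_rw [aeval_cons_monomial, hz]
  rw [aeval_weighted_monomial, ← mul_assoc, ← pow_add,
    Nat.sub_add_cancel (hf u (mem_support_iff.1 hu))]

/-- Substituting `x₀ = 1` undoes homogenization, in whatever degree. -/
theorem aeval_homogenizeAt_one (W : Fin n → ℕ) (d : ℕ) (f : MvPolynomial (Fin n) K) :
    aeval (Fin.cons 1 X : Fin (n + 1) → MvPolynomial (Fin n) K) (homogenizeAt W d f) = f := by
  conv_rhs => rw [f.as_sum]
  rw [homogenizeAt_apply, map_sum]
  refine Finset.sum_congr rfl fun u hu => ?_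
  rw [aeval_cons_monomial]
  simp only [Fin.cons_zero, Fin.cons_succ, one_pow, one_mul]
  exact aeval_X_left_apply _

/-- Substituting `x₀ = 0` in a homogenization leaves the degree form. -/
theorem aeval_homogenize_zero {A : Type*} [CommRing A] [Algebra K A] (W : Fin n → ℕ)
    (f : MvPolynomial (Fin n) K) (z : Fin (n + 1) → A) (hz : z 0 = 0) :
    aeval z (homogenize W f) = aeval (fun i : Fin n => z i.succ) (degreeForm W f) := by
  classical
  rw [degreeForm, weightedHomogeneousComponent_apply, homogenize, map_sum, map_sum,
    Finset.sum_filter]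
  refine Finset.sum_congr rfl fun u hu => ?_
  rw [aeval_cons_monomial, hz]
  have := le_weightedTotalDegree W hu
  split_ifs with h
  · rw [h, Nat.sub_self, pow_zero, one_mul]
  · rw [zero_pow (by omega), zero_mul]

theorem homogenizeAt_of_le (W : Fin n → ℕ) {d e : ℕ} (hde : d ≤ e) {f : MvPolynomial (Fin n) K}
    (hf : ∀ u, coeff u f ≠ 0 → Finsupp.weight W u ≤ d) :
    homogenizeAt W e f = X 0 ^ (e - d) * homogenizeAt W d f := by
  rw [homogenizeAt_apply, homogenizeAt_apply, Finset.mul_sum]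
  refine Finset.sum_congr rfl fun u hu => ?_
  have := hf u (mem_support_iff.1 hu)
  rw [X_pow_eq_monomial, monomial_mul, one_mul]
  refine congrArg (fun v => monomial v (coeff u f)) (Finsupp.ext fun i => ?_)
  refine Fin.cases ?_ (fun i => ?_) i
  · simp
    omega
  · simp

theorem homogenizeAt_monomial_mul (W : Fin n → ℕ) {d : ℕ} (s : Fin n →₀ ℕ)
    {f : MvPolynomial (Fin n) K} :
    homogenizeAt W (Finsupp.weight W s + d) (monomial s 1 * f) =
      monomial (Finsupp.cons 0 s) 1 * homogenizeAt W d f := by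
  conv_lhs => rw [f.as_sum]
  rw [homogenizeAt_apply W d, Finset.mul_sum, Finset.mul_sum, map_sum]
  refine Finset.sum_congr rfl fun u hu => ?_
  rw [monomial_mul, homogenizeAt_monomial, monomial_mul, map_add, Nat.add_sub_add_left]
  refine congrArg (fun v => monomial v (1 * coeff u f)) (Finsupp.ext fun i => ?_)
  refine Fin.cases ?_ (fun i => ?_) i <;> simp

end Homogenization

/-! ### Reduction modulo the border basis -/

section Reduction

variable {K : Type*} [Field K] {n : ℕ} {O : Set (Fin n →₀ ℕ)}
  {I : Ideal (MvPolynomial (Fin n) K)} {g : border O → MvPolynomial (Fin n) K} {W : Fin n → ℕ}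

/-- The terms of `O` that may occur in the normal form of the term `u`: the term `u` itself, and
the terms of smaller weighted degree. -/
def reductionTerms (O : Set (Fin n →₀ ℕ)) (W : Fin n → ℕ) (u : Fin n →₀ ℕ) :
    Set (Fin n →₀ ℕ) :=
  {t | t ∈ O ∧ (t = u ∨ Finsupp.weight W t < Finsupp.weight W u)}

theorem reductionTerms_subset (u : Fin n →₀ ℕ) : reductionTerms O W u ⊆ O := fun _ h => h.1

theorem weight_le_of_mem_reductionTerms {u t : Fin n →₀ ℕ} (ht : t ∈ reductionTerms O W u) :
    Finsupp.weight W t ≤ Finsupp.weight W u := by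
  rcases ht.2 with rfl | h
  · exact le_rfl
  · exact h.le

/-- Homogeneous reduction: a term `u = s b` outside `O` is replaced by `s (b - g_b)`, all of whose
terms have smaller weighted degree; the process is carried out in the homogenizations. -/
theorem IsBorderPrebasis.exists_reduction (hg : IsBorderPrebasis O I g) (hO : IsLowerSet O)
    (hne : O.Nonempty) (hW : ∀ b, degreeForm W (g b) = monomial b.1 1) (u : Fin n →₀ ℕ) :
    ∃ r ∈ termSpan K (reductionTerms O W u),
      homogenizeAt W (Finsupp.weight W u) (monomial u 1 - r) ∈
        Ideal.span (Set.range fun b => homogenize W (g b)) := by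
  set H := Ideal.span (Set.range fun b => homogenize W (g b))
  induction hd : Finsupp.weight W u using Nat.strong_induction_on generalizing u with
  | _ d ih =>
  by_cases hu : u ∈ O
  · refine ⟨monomial u 1, Submodule.subset_span ⟨u, ⟨hu, Or.inl rfl⟩, rfl⟩, ?_⟩
    rw [sub_self, map_zero]
    exact H.zero_mem
  obtain ⟨b, hb, hbu⟩ := exists_border_le hO hne hu
  obtain ⟨s, rfl⟩ := exists_add_of_le hbu
  set q := monomial b 1 - g ⟨b, hb⟩ with hq
  have hlt : ∀ t, coeff t (g ⟨b, hb⟩) ≠ 0 → t ≠ b →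
      Finsupp.weight W t < Finsupp.weight W b :=
    (degreeForm_eq_monomial_iff W (hg.coeff_self ⟨b, hb⟩)).1 (hW ⟨b, hb⟩)
  have hqlt : ∀ t, coeff t q ≠ 0 → Finsupp.weight W t < Finsupp.weight W b := by
    intro t ht
    rcases eq_or_ne t b with rfl | h
    · rw [hq, coeff_sub, hg.coeff_self ⟨t, hb⟩, coeff_monomial, if_pos rfl, sub_self] at ht
      exact (ht rfl).elim
    · refine hlt t (fun h' => ht ?_) h
      rw [hq, coeff_sub, h', coeff_monomial, if_neg h.symm, sub_zero]
  have hdeg : weightedTotalDegree W (g ⟨b, hb⟩) = Finsupp.weight W b := by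
    refine le_antisymm (Finset.sup_le fun t ht => ?_)
      (weight_le_of_coeff_ne_zero W _ _ (by rw [hg.coeff_self ⟨b, hb⟩]; exact one_ne_zero))
    rcases eq_or_ne t b with rfl | hne
    · exact le_rfl
    · exact (hlt t (mem_support_iff.1 ht) hne).le
  have hd' : d = Finsupp.weight W s + Finsupp.weight W b := by rw [← hd, map_add, add_comm]
  -- the reduction of each term `s t` of `s (b - g_b)`
  have hred : ∀ t ∈ q.support, ∃ r ∈ termSpan K (reductionTerms O W (b + s)),
      homogenizeAt W d (monomial (s + t) 1 - r) ∈ H := by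
    intro t ht
    have hst : Finsupp.weight W (s + t) < d := by
      rw [map_add, hd']
      exact Nat.add_lt_add_left (hqlt t (mem_support_iff.1 ht)) _
    obtain ⟨r, hr, hrH⟩ := ih _ hst (s + t) rfl
    refine ⟨r, termSpan_mono ?_ hr, ?_⟩
    · intro t' ht'
      refine ⟨ht'.1, Or.inr ?_⟩
      rw [hd]
      exact (weight_le_of_mem_reductionTerms ht').trans_lt hst
    · rw [homogenizeAt_of_le W hst.le]
      · exact H.mul_mem_left _ hrH
      · intro t' ht'
        by_cases h : t' = s + t
        · rw [h]
        · rw [coeff_sub, coeff_monomial, if_neg (Ne.symm h), zero_sub, neg_ne_zero] at ht'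
          exact weight_le_of_mem_reductionTerms (mem_termSpan.1 hr t' ht')
  choose! r hr hrH using hred
  refine ⟨∑ t ∈ q.support, coeff t q • r t,
    Submodule.sum_mem _ fun t ht => Submodule.smul_mem _ _ (hr t ht), ?_⟩
  have hsq : monomial s 1 * q = ∑ t ∈ q.support, coeff t q • monomial (s + t) (1 : K) := by
    conv_lhs => rw [q.as_sum]
    rw [Finset.mul_sum]
    refine Finset.sum_congr rfl fun t _ => ?_
    rw [monomial_mul, smul_monomial, one_mul, smul_eq_mul, mul_one]
  have hsplit : monomial (b + s) 1 - ∑ t ∈ q.support, coeff t q • r t =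
      monomial s 1 * g ⟨b, hb⟩ +
        ∑ t ∈ q.support, coeff t q • (monomial (s + t) (1 : K) - r t) := by
    simp_rw [smul_sub, Finset.sum_sub_distrib]
    rw [← hsq, hq, mul_sub, monomial_mul, mul_one, add_comm b s]
    ring
  rw [hsplit, map_add, map_sum]
  refine H.add_mem ?_ (H.sum_mem fun t ht => ?_)
  · rw [hd', homogenizeAt_monomial_mul, ← hdeg, ← homogenize_eq_homogenizeAt]
    exact H.mul_mem_left _ (Ideal.subset_span ⟨_, rfl⟩)
  · rw [map_smul]
    exact (H.restrictScalars K).smul_mem _ (hrH t ht)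

/-- Reduction of a polynomial of weighted degree at most `d`. -/
theorem IsBorderPrebasis.exists_reduction_of_le (hg : IsBorderPrebasis O I g)
    (hO : IsLowerSet O) (hne : O.Nonempty) (hW : ∀ b, degreeForm W (g b) = monomial b.1 1)
    {d : ℕ} {f : MvPolynomial (Fin n) K}
    (hf : ∀ u, coeff u f ≠ 0 → Finsupp.weight W u ≤ d) :
    ∃ r ∈ termSpan K {t | t ∈ O ∧ Finsupp.weight W t ≤ d}, homogenizeAt W d (f - r) ∈
        Ideal.span (Set.range fun b => homogenize W (g b)) := by
  choose r hr hrH using hg.exists_reduction hO hne hW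
  refine ⟨∑ u ∈ f.support, coeff u f • r u,
    Submodule.sum_mem _ fun u hu => Submodule.smul_mem _ _ (termSpan_mono ?_ (hr u)), ?_⟩
  · exact fun t ht => ⟨ht.1, (weight_le_of_mem_reductionTerms ht).trans
      (hf u (mem_support_iff.1 hu))⟩
  have : f - ∑ u ∈ f.support, coeff u f • r u =
      ∑ u ∈ f.support, coeff u f • (monomial u 1 - r u) := by
    simp_rw [smul_sub, Finset.sum_sub_distrib, smul_monomial, smul_eq_mul, mul_one]
    rw [← f.as_sum]
  rw [this, map_sum]
  refine Ideal.sum_mem _ fun u hu => ?_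
  rw [map_smul]
  refine Submodule.smul_of_tower_mem _ _ ?_
  rw [homogenizeAt_of_le W (hf u (mem_support_iff.1 hu))]
  · exact Ideal.mul_mem_left _ _ (hrH u)
  · intro t ht
    by_cases h : t = u
    · rw [h]
    · rw [coeff_sub, coeff_monomial, if_neg (Ne.symm h), zero_sub, neg_ne_zero] at ht
      exact weight_le_of_mem_reductionTerms (mem_termSpan.1 (hr u) t ht)

theorem aeval_mem_span_of_mem_span {p : MvPolynomial (Fin (n + 1)) K}
    (hp : p ∈ Ideal.span (Set.range fun b => homogenize W (g b))) :
    aeval (Fin.cons 1 X : Fin (n + 1) → MvPolynomial (Fin n) K) p ∈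
      Ideal.span (Set.range g) := by
  have := Ideal.mem_map_of_mem
    (aeval (Fin.cons 1 X : Fin (n + 1) → MvPolynomial (Fin n) K)) hp
  rw [Ideal.map_span, ← Set.range_comp] at this
  have h : ⇑(aeval (Fin.cons 1 X : Fin (n + 1) → MvPolynomial (Fin n) K)) ∘
      (fun b => homogenize W (g b)) = g := by
    funext b
    rw [Function.comp_apply, homogenize_eq_homogenizeAt, aeval_homogenizeAt_one]
  rwa [h] at this

theorem IsBorderPrebasis.span_le (hg : IsBorderPrebasis O I g) :
    Ideal.span (Set.range g) ≤ I :=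
  Ideal.span_le.2 (by rintro _ ⟨b, rfl⟩; exact (hg b).1)

/-- Reduction of elements of `I` in the homogenizations leaves no remainder, as
`I ∩ ⟨O⟩_K = 0`. -/
theorem IsBorderBasis.homogenizeAt_mem_span (hg : IsBorderBasis O I g) (hO : IsLowerSet O)
    (hne : O.Nonempty) (hW : ∀ b, degreeForm W (g b) = monomial b.1 1)
    {d : ℕ} {f : MvPolynomial (Fin n) K} (hfI : f ∈ I)
    (hf : ∀ u, coeff u f ≠ 0 → Finsupp.weight W u ≤ d) :
    homogenizeAt W d f ∈ Ideal.span (Set.range fun b => homogenize W (g b)) := by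
  obtain ⟨r, hr, hrH⟩ := hg.1.exists_reduction_of_le hO hne hW hf
  have h := hg.1.span_le (aeval_mem_span_of_mem_span hrH)
  rw [aeval_homogenizeAt_one] at h
  have hrI : r ∈ I := by simpa using I.sub_mem hfI h
  have : r = 0 := (Submodule.disjoint_def.1 hg.2.disjoint) r hrI
    (termSpan_mono (fun t ht => ht.1) hr)
  rwa [this, sub_zero] at hrH

theorem IsBorderBasis.homIdeal_eq_span (hg : IsBorderBasis O I g) (hO : IsLowerSet O)
    (hne : O.Nonempty) (hW : ∀ b, degreeForm W (g b) = monomial b.1 1) :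
    homIdeal W I = Ideal.span (Set.range fun b => homogenize W (g b)) := by
  refine le_antisymm (Ideal.span_le.2 ?_) (Ideal.span_mono ?_)
  · rintro _ ⟨f, hf, rfl⟩
    rw [homogenize_eq_homogenizeAt]
    exact hg.homogenizeAt_mem_span hO hne hW hf (weight_le_of_coeff_ne_zero W f)
  · rintro _ ⟨b, rfl⟩
    exact ⟨g b, (hg.1 b).1, rfl⟩

theorem IsBorderBasis.eq_span (hg : IsBorderBasis O I g) (hO : IsLowerSet O)
    (hne : O.Nonempty) (hW : ∀ b, degreeForm W (g b) = monomial b.1 1) :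
    I = Ideal.span (Set.range g) := by
  refine le_antisymm (fun f hf => ?_) hg.1.span_le
  have := aeval_mem_span_of_mem_span
    (hg.homogenizeAt_mem_span hO hne hW hf (weight_le_of_coeff_ne_zero W f))
  rwa [aeval_homogenizeAt_one] at this

/-- No term of `O` occurs in the degree form of an element `f` of `I`: the normal form of `f` is
zero, but replacing the terms `u` of `f` by their normal forms does not affect the coefficient of
a term `t` of `O` of maximal weighted degree. -/
theorem IsBorderBasis.degreeForm_mem (hg : IsBorderBasis O I g) (hO : IsLowerSet O)
    (hne : O.Nonempty) (hW : ∀ b, degreeForm W (g b) = monomial b.1 1)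
    {f : MvPolynomial (Fin n) K} (hf : f ∈ I) :
    degreeForm W f ∈ borderTermIdeal K O := by
  classical
  refine mem_ideal_span_monomial_image.2 fun t ht => exists_border_le hO hne fun htO => ?_
  rw [mem_support_iff, degreeForm, coeff_weightedHomogeneousComponent] at ht
  obtain ⟨hwt, htf⟩ := ite_ne_right_iff.1 ht
  have hred : ∀ u, ∃ r ∈ termSpan K (reductionTerms O W u), monomial u 1 - r ∈ I := by
    intro u
    obtain ⟨r, hr, hrH⟩ := hg.1.exists_reduction hO hne hW u
    refine ⟨r, hr, hg.1.span_le ?_⟩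
    have := aeval_mem_span_of_mem_span hrH
    rwa [aeval_homogenizeAt_one] at this
  choose r hr hrI using hred
  have hdis := Submodule.disjoint_def.1 hg.2.disjoint
  have hsub : f - ∑ u ∈ f.support, coeff u f • r u =
      ∑ u ∈ f.support, coeff u f • (monomial u 1 - r u) := by
    simp_rw [smul_sub, Finset.sum_sub_distrib, smul_monomial, smul_eq_mul, mul_one]
    rw [← f.as_sum]
  have hsum : ∑ u ∈ f.support, coeff u f • r u = 0 := by
    refine hdis _ ?_ (Submodule.sum_mem _ fun u _ => Submodule.smul_mem _ _
      (termSpan_mono (reductionTerms_subset u) (hr u)))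
    have : f - ∑ u ∈ f.support, coeff u f • r u ∈ I := by
      rw [hsub]
      exact I.sum_mem fun u _ => Submodule.smul_mem (I.restrictScalars K) _ (hrI u)
    simpa using I.sub_mem hf this
  have hrt : r t = monomial t 1 := by
    have h := hdis (monomial t 1 - r t) (hrI t) (Submodule.sub_mem _
      (Submodule.subset_span ⟨t, htO, rfl⟩) (termSpan_mono (reductionTerms_subset t) (hr t)))
    exact (sub_eq_zero.1 h).symm
  have h0 : ∀ u ∈ f.support, u ≠ t → coeff t (coeff u f • r u) = 0 := by
    intro u hu hut
    by_contra h
    have htu := mem_termSpan.1 (hr u) t (by rw [coeff_smul] at h; exact right_ne_zero_of_smul h)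
    rcases htu.2 with rfl | hlt
    · exact hut rfl
    · rw [hwt] at hlt
      exact absurd (le_weightedTotalDegree W hu) (not_le.2 hlt)
  have := congrArg (coeff t) hsum
  rw [coeff_sum, Finset.sum_eq_single t h0 (fun h => (h (mem_support_iff.2 htf)).elim), hrt,
    coeff_smul, coeff_monomial, if_pos rfl, smul_eq_mul, mul_one, coeff_zero] at this
  exact htf this

theorem IsBorderBasis.isMacaulayBasis (hg : IsBorderBasis O I g) (hO : IsLowerSet O)
    (hne : O.Nonempty) (hW : ∀ b, degreeForm W (g b) = monomial b.1 1) :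
    IsMacaulayBasis W I (Set.range g) := by
  refine ⟨?_, le_antisymm (Ideal.span_le.2 ?_) (Ideal.span_mono ?_)⟩
  · rintro _ ⟨b, rfl⟩
    exact ⟨(hg.1 b).1, hg.1.ne_zero b⟩
  · rintro _ ⟨f, hf, -, rfl⟩
    have : degreeForm W '' Set.range g = (fun t => monomial t 1) '' border O := by
      rw [← Set.range_comp, Set.image_eq_range]
      exact congrArg Set.range (funext hW)
    rw [this]
    exact hg.degreeForm_mem hO hne hW hf
  · rintro _ ⟨_, ⟨b, rfl⟩, rfl⟩
    exact ⟨g b, (hg.1 b).1, hg.1.ne_zero b, rfl⟩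

end Reduction

/-! ### The graded free module structure -/

section GradedFree

variable {K : Type*} [Field K] {n : ℕ}

theorem isInternal_quotientPart (V : Fin (n + 1) → ℕ) (J : Ideal (MvPolynomial (Fin (n + 1)) K))
    (hJ : letI := weightedGradedAlgebra K V
      J.IsHomogeneous (weightedHomogeneousSubmodule K V)) :
    DirectSum.IsInternal (quotientPart V J) := by
  let := weightedGradedAlgebra K V
  refine DirectSum.isInternal_submodule_of_iSupIndep_of_iSup_eq_top ?_ ?_
  · rw [iSupIndep_iff_finsetSum_eq_zero_imp_eq_zero]
    intro s a ha h d hd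
    choose F hF hFa using fun i : s => Submodule.mem_map.1 (ha i.1 i.2)
    have hsum : ∑ i : s, F i ∈ J := by
      rw [← Ideal.Quotient.eq_zero_iff_mem, map_sum, ← h, ← Finset.sum_coe_sort s a]
      exact Finset.sum_congr rfl fun i _ => hFa i
    have hcomp := weightedHomogeneousComponent_mem_of_mem K V hJ hsum d
    rw [map_sum, Finset.sum_eq_single ⟨d, hd⟩] at hcomp
    · rw [IsWeightedHomogeneous.weightedHomogeneousComponent_same (hF ⟨d, hd⟩)] at hcomp
      rw [← hFa ⟨d, hd⟩]
      exact Ideal.Quotient.eq_zero_iff_mem.2 hcomp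
    · intro i _ hi
      refine IsWeightedHomogeneous.weightedHomogeneousComponent_ne d (hF i) fun h' => hi ?_
      exact Subtype.ext h'.symm
    · exact fun h' => (h' (Finset.mem_univ _)).elim
  · change ⨆ d, (weightedHomogeneousSubmodule K V d).map (Ideal.Quotient.mkₐ K J).toLinearMap = ⊤
    rw [← Submodule.map_iSup, (DirectSum.Decomposition.isInternal
      (weightedHomogeneousSubmodule K V)).submodule_iSup_eq_top, Submodule.map_top,
      LinearMap.range_eq_top]
    exact Ideal.Quotient.mkₐ_surjective K J

theorem familyMap_X_mul_mem (W : Fin n → ℕ) (J : Ideal (MvPolynomial (Fin (n + 1)) K)) (d : ℕ)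
    (a : MvPolynomial (Fin (n + 1)) K ⧸ J) (ha : a ∈ quotientPart (extWeight W) J d) :
    familyMap J Polynomial.X * a ∈ quotientPart (extWeight W) J (d + 1) := by
  obtain ⟨F, hF, rfl⟩ := ha
  refine ⟨X 0 * F, ?_, ?_⟩
  · have h := (isWeightedHomogeneous_X K (extWeight W) 0).mul hF
    rwa [show extWeight W 0 + d = d + 1 from add_comm _ _] at h
  · rw [familyMap, Polynomial.aeval_X]
    exact map_mul (Ideal.Quotient.mk J) _ _

theorem familyMap_apply (J : Ideal (MvPolynomial (Fin (n + 1)) K)) (p : Polynomial K) :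
    familyMap J p = Ideal.Quotient.mk J (Polynomial.aeval (X 0) p) := by
  rw [familyMap]
  exact Polynomial.aeval_algHom_apply (Ideal.Quotient.mkₐ K J) (X 0) p

/-- The substitution `x₀ = T`, `xᵢ = T^wᵢ xᵢ` with values in `P[T]`. -/
noncomputable def rescale (K : Type*) [Field K] {n : ℕ} (W : Fin n → ℕ) :
    MvPolynomial (Fin (n + 1)) K →ₐ[K] Polynomial (MvPolynomial (Fin n) K) :=
  aeval (Fin.cons Polynomial.X fun i => Polynomial.X ^ W i * Polynomial.C (X i))

theorem aeval_C_X (f : MvPolynomial (Fin n) K) :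
    aeval (fun i => (Polynomial.C (X i) : Polynomial (MvPolynomial (Fin n) K))) f =
      Polynomial.C f := by
  have h : aeval (fun i => (Polynomial.C (X i) : Polynomial (MvPolynomial (Fin n) K))) =
      (Polynomial.CAlgHom : MvPolynomial (Fin n) K →ₐ[MvPolynomial (Fin n) K] _).restrictScalars
        K := by
    refine algHom_ext fun i => ?_
    rw [aeval_X]
    rfl
  rw [h]
  rfl

/-- As `f^hom` is sent to `T^d f`, the homogenization of `I` is mapped into the extension of `I`
to `P[T]`. -/
theorem coeff_rescale_mem (W : Fin n → ℕ) (I : Ideal (MvPolynomial (Fin n) K))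
    {F : MvPolynomial (Fin (n + 1)) K} (hF : F ∈ homIdeal W I) (k : ℕ) :
    (rescale K W F).coeff k ∈ I := by
  revert k
  rw [← Ideal.mem_map_C_iff, ← Ideal.mem_comap]
  revert F
  change homIdeal W I ≤ _
  refine Ideal.span_le.2 ?_
  rintro _ ⟨f, hf, rfl⟩
  rw [SetLike.mem_coe, Ideal.mem_comap, homogenize_eq_homogenizeAt, rescale,
    aeval_homogenizeAt W (weight_le_of_coeff_ne_zero W f) _ (fun i : Fin n => (Polynomial.C (X i) : Polynomial (MvPolynomial (Fin n) K)))
      (fun i => by simp), aeval_C_X]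
  exact Ideal.mul_mem_left _ _ (Ideal.mem_map_of_mem _ hf)

theorem coeff_rescale_mul_monomial (W : Fin n → ℕ) (p : Polynomial K) (t : Fin n →₀ ℕ) (N : ℕ) :
    (rescale K W (Polynomial.aeval (X 0) p * monomial (Finsupp.cons 0 t) 1)).coeff N =
      monomial t (if Finsupp.weight W t ≤ N then p.coeff (N - Finsupp.weight W t) else 0) := by
  have h1 : rescale K W (Polynomial.aeval (X 0) p) = p.map C := by
    rw [← Polynomial.aeval_algHom_apply, rescale, aeval_X, Fin.cons_zero,
      Polynomial.aeval_X_left_eq_map]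
    rfl
  have h2 : rescale K W (monomial (Finsupp.cons 0 t) 1) =
      Polynomial.C (monomial t 1) * Polynomial.X ^ Finsupp.weight W t := by
    rw [rescale, aeval_cons_monomial, pow_zero, one_mul]
    simp only [Fin.cons_succ]
    rw [aeval_weighted_monomial, aeval_C_X, mul_comm]
  rw [map_mul, h1, h2, ← mul_assoc, Polynomial.coeff_mul_X_pow', Polynomial.coeff_mul_C,
    Polynomial.coeff_map]
  split_ifs
  · rw [C_mul_monomial, mul_one]
  · rw [map_zero]

variable {O : Set (Fin n →₀ ℕ)} {I : Ideal (MvPolynomial (Fin n) K)}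
  {g : border O → MvPolynomial (Fin n) K} {W : Fin n → ℕ}

/-- The residue class of the term `t` in `K[x₀, …, xₙ] / I^hom`. -/
noncomputable def termClass (W : Fin n → ℕ) (I : Ideal (MvPolynomial (Fin n) K))
    (t : Fin n →₀ ℕ) : MvPolynomial (Fin (n + 1)) K ⧸ homIdeal W I :=
  Ideal.Quotient.mk _ (monomial (Finsupp.cons 0 t) 1)

theorem termClass_mem (t : Fin n →₀ ℕ) :
    termClass W I t ∈ quotientPart (extWeight W) (homIdeal W I) (Finsupp.weight W t) := by
  refine ⟨_, isWeightedHomogeneous_monomial _ _ _ ?_, rfl⟩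
  rw [weight_cons, zero_add]

/-- Independence of the classes of the terms of `O` over `K[x₀]`: a relation is sent by
`rescale` to a polynomial in `T` with coefficients in `I ∩ ⟨O⟩_K = 0`. -/
theorem linearIndependent_termClass
    (h : Disjoint (I.restrictScalars K) (termSpan K O)) :
    letI : Module (Polynomial K) (MvPolynomial (Fin (n + 1)) K ⧸ homIdeal W I) :=
      Module.compHom _ (familyMap (homIdeal W I)).toRingHom
    LinearIndependent (Polynomial K) fun t : O => termClass W I t.1 := by
  classical
  let : Module (Polynomial K) (MvPolynomial (Fin (n + 1)) K ⧸ homIdeal W I) :=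
    Module.compHom _ (familyMap (homIdeal W I)).toRingHom
  rw [linearIndependent_iff']
  intro s p hp t ht
  have hmem : ∑ t ∈ s, Polynomial.aeval (X 0) (p t) * monomial (Finsupp.cons 0 t.1) (1 : K) ∈
      homIdeal W I := by
    rw [← Ideal.Quotient.eq_zero_iff_mem, map_sum, ← hp]
    refine Finset.sum_congr rfl fun t _ => ?_
    rw [map_mul, ← familyMap_apply]
    rfl
  ext k
  have hN := coeff_rescale_mem W I hmem (k + Finsupp.weight W t.1)
  rw [map_sum, Polynomial.finsetSum_coeff] at hN
  simp_rw [coeff_rescale_mul_monomial] at hN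
  have h0 := Submodule.disjoint_def.1 h _ hN (Submodule.sum_mem _ fun t' _ =>
    mem_termSpan.2 fun u hu => by
      rw [coeff_monomial] at hu
      rw [← (ite_ne_right_iff.1 hu).1]
      exact t'.2)
  have := congrArg (coeff t.1) h0
  rw [coeff_sum, Finset.sum_eq_single t] at this
  · simpa using this
  · intro t' _ hne
    rw [coeff_monomial, if_neg fun h' => hne (Subtype.ext h')]
  · exact fun h' => (h' ht).elim

theorem IsBorderBasis.span_termClass (hg : IsBorderBasis O I g) (hO : IsLowerSet O)
    (hne : O.Nonempty) (hW : ∀ b, degreeForm W (g b) = monomial b.1 1) :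
    letI : Module (Polynomial K) (MvPolynomial (Fin (n + 1)) K ⧸ homIdeal W I) :=
      Module.compHom _ (familyMap (homIdeal W I)).toRingHom
    Submodule.span (Polynomial K) (Set.range fun t : O => termClass W I t.1) = ⊤ := by
  let : Module (Polynomial K) (MvPolynomial (Fin (n + 1)) K ⧸ homIdeal W I) :=
    Module.compHom _ (familyMap (homIdeal W I)).toRingHom
  set M := Submodule.span (Polynomial K) (Set.range fun t : O => termClass W I t.1)
  have hsmul : ∀ (k : ℕ) (u : Fin n →₀ ℕ) (a : K), termClass W I u ∈ M →
      Ideal.Quotient.mk (homIdeal W I) (monomial (Finsupp.cons k u) a) ∈ M := by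
    intro k u a hu
    convert M.smul_mem (Polynomial.monomial k a) hu using 1
    change _ = familyMap (homIdeal W I) _ * _
    rw [familyMap_apply, termClass, ← map_mul, Polynomial.aeval_monomial, X_pow_eq_monomial,
      algebraMap_eq, C_mul_monomial, monomial_mul, mul_one, mul_one]
    refine congrArg (fun v => Ideal.Quotient.mk (homIdeal W I) (monomial v a))
      (Finsupp.ext fun i => ?_)
    refine Fin.cases ?_ (fun i => ?_) i <;> simp
  have hterm : ∀ u, termClass W I u ∈ M := by
    intro u
    obtain ⟨r, hr, hrH⟩ := hg.1.exists_reduction hO hne hW u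
    rw [← hg.homIdeal_eq_span hO hne hW, map_sub, ← Ideal.Quotient.eq, homogenizeAt_monomial,
      Nat.sub_self] at hrH
    rw [termClass, hrH, homogenizeAt_apply, map_sum]
    refine M.sum_mem fun t ht => hsmul _ _ _ (Submodule.subset_span ⟨⟨t, ?_⟩, rfl⟩)
    exact (mem_termSpan.1 hr t (mem_support_iff.1 ht)).1
  rw [eq_top_iff]
  rintro a -
  obtain ⟨F, rfl⟩ := Ideal.Quotient.mk_surjective a
  rw [F.as_sum, map_sum]
  refine M.sum_mem fun v _ => ?_
  rw [← Finsupp.cons_tail v]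
  exact hsmul _ _ _ (hterm _)

theorem IsBorderBasis.isGradedFree (hg : IsBorderBasis O I g) (hO : IsLowerSet O)
    (hne : O.Nonempty) (hW : ∀ b, degreeForm W (g b) = monomial b.1 1) :
    IsGradedFree (familyMap (homIdeal W I)) (quotientPart (extWeight W) (homIdeal W I)) := by
  refine ⟨isInternal_quotientPart _ _ (isHomogeneous_homIdeal W I),
    familyMap_X_mul_mem W _, Set.range fun t : O => termClass W I t.1, ?_, ?_, ?_⟩
  · rintro _ ⟨t, rfl⟩
    exact ⟨_, termClass_mem t.1⟩
  · let : Module (Polynomial K) (MvPolynomial (Fin (n + 1)) K ⧸ homIdeal W I) :=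
      Module.compHom _ (familyMap (homIdeal W I)).toRingHom
    exact (linearIndependent_termClass hg.2.disjoint).linearIndepOn_id
  · exact hg.span_termClass hO hne hW

theorem IsGradedFree.flat {A : Type*} [CommRing A] [Algebra K A] {φ : Polynomial K →ₐ[K] A}
    {𝒜 : ℕ → Submodule K A} (h : IsGradedFree φ 𝒜) : φ.toRingHom.Flat := by
  obtain ⟨-, -, B, -, hli, hspan⟩ := h
  let : Module (Polynomial K) A := Module.compHom A φ.toRingHom
  have : Module.Free (Polynomial K) A :=
    Module.Free.of_basis (Module.Basis.mk (v := fun b : B => (b : A)) hli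
      (by rw [Subtype.range_coe]; exact hspan.ge))
  have : Module.Flat (Polynomial K) A := inferInstance
  exact this

end GradedFree

/-! ### The fibers of the family -/

section Fibers

variable {K : Type*} [Field K] {n : ℕ}

theorem aeval_mk_X {τ : Type*} (J : Ideal (MvPolynomial τ K)) (p : MvPolynomial τ K) :
    aeval (fun i => Ideal.Quotient.mk J (X i)) p = Ideal.Quotient.mk J p := by
  have h : aeval (fun i => Ideal.Quotient.mk J (X i)) = Ideal.Quotient.mkₐ K J :=
    algHom_ext fun i => by rw [aeval_X]; rfl
  rw [h]
  rfl

/-- The isomorphism induced by `x₀ ↦ c`, `xᵢ ↦ aᵢ xᵢ` with inverse `xᵢ ↦ aᵢ⁻¹ xᵢ`. -/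
theorem nonempty_fiber_algEquiv (J : Ideal (MvPolynomial (Fin (n + 1)) K))
    (I : Ideal (MvPolynomial (Fin n) K)) (x : MvPolynomial (Fin (n + 1)) K) (c : K)
    (hx : x = X 0 - C c) (a : Fin n → K) (ha : ∀ i, a i ≠ 0)
    (hJ : ∀ p ∈ J, aeval (Fin.cons (algebraMap K _ c)
      (fun i => a i • Ideal.Quotient.mk I (X i)) :
        Fin (n + 1) → MvPolynomial (Fin n) K ⧸ I) p = 0)
    (hI : ∀ f ∈ I, aeval (fun i : Fin n =>
      (a i)⁻¹ • Ideal.Quotient.mk (J ⊔ Ideal.span {x}) (X i.succ)) f = 0) :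
    Nonempty ((MvPolynomial (Fin (n + 1)) K ⧸ (J ⊔ Ideal.span {x})) ≃ₐ[K]
      (MvPolynomial (Fin n) K ⧸ I)) := by
  set z : Fin (n + 1) → MvPolynomial (Fin n) K ⧸ I := Fin.cons (algebraMap K _ c)
    (fun i => a i • Ideal.Quotient.mk I (X i)) with hz
  set y : Fin n → MvPolynomial (Fin (n + 1)) K ⧸ (J ⊔ Ideal.span {x}) :=
    fun i => (a i)⁻¹ • Ideal.Quotient.mk (J ⊔ Ideal.span {x}) (X i.succ) with hy
  have hker : ∀ p ∈ J ⊔ Ideal.span {x}, aeval z p = 0 := by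
    change J ⊔ Ideal.span {x} ≤ RingHom.ker (aeval z)
    refine sup_le (fun p hp => hJ p hp) ((Ideal.span_singleton_le_iff_mem _).2 ?_)
    rw [RingHom.mem_ker, hx, map_sub, aeval_X, aeval_C, hz, Fin.cons_zero, sub_self]
  refine ⟨AlgEquiv.ofAlgHom (Ideal.Quotient.liftₐ _ (aeval z) hker)
    (Ideal.Quotient.liftₐ _ (aeval y) hI) ?_ ?_⟩
  · refine Ideal.Quotient.algHom_ext _ (algHom_ext fun i => ?_)
    change Ideal.Quotient.liftₐ _ (aeval z) hker (aeval y (X i)) =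
      Ideal.Quotient.mk I (X i)
    rw [aeval_X, hy, map_smul]
    change (a i)⁻¹ • aeval z (X i.succ) = _
    rw [aeval_X, hz, Fin.cons_succ, smul_smul, inv_mul_cancel₀ (ha i), one_smul]
  · refine Ideal.Quotient.algHom_ext _ (algHom_ext fun i => ?_)
    change Ideal.Quotient.liftₐ _ (aeval y) hI (aeval z (X i)) = Ideal.Quotient.mk _ (X i)
    rw [aeval_X]
    refine Fin.cases ?_ (fun i => ?_) i
    · rw [hz, Fin.cons_zero, AlgHom.commutes]
      refine (Ideal.Quotient.eq.2 ?_).symm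
      rw [algebraMap_eq, ← hx]
      exact Ideal.mem_sup_right (Ideal.mem_span_singleton_self x)
    · rw [hz, Fin.cons_succ, map_smul]
      change a i • aeval y (X i) = _
      rw [aeval_X, hy, smul_smul, mul_inv_cancel₀ (ha i), one_smul]

theorem nonempty_general_fiber_algEquiv (W : Fin n → ℕ) (I : Ideal (MvPolynomial (Fin n) K))
    {c : K} (hc : c ≠ 0) :
    Nonempty ((MvPolynomial (Fin (n + 1)) K ⧸ (homIdeal W I ⊔ Ideal.span {X 0 - C c})) ≃ₐ[K]
      (MvPolynomial (Fin n) K ⧸ I)) := by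
  refine nonempty_fiber_algEquiv _ _ _ c rfl (fun i => c ^ W i)
    (fun i => pow_ne_zero _ hc) ?_ ?_
  · change homIdeal W I ≤ RingHom.ker (aeval _)
    refine Ideal.span_le.2 ?_
    rintro _ ⟨f, hf, rfl⟩
    have hsmul : ∀ i, c ^ W i • Ideal.Quotient.mk I (X i) =
        algebraMap K (MvPolynomial (Fin n) K ⧸ I) c ^ W i * Ideal.Quotient.mk I (X i) :=
      fun i => by
        rw [← map_pow]
        exact Algebra.smul_def (c ^ W i) (Ideal.Quotient.mk I (X i))
    rw [SetLike.mem_coe, RingHom.mem_ker, homogenize_eq_homogenizeAt,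
      aeval_homogenizeAt W (weight_le_of_coeff_ne_zero W f) _
        (fun i => Ideal.Quotient.mk I (X i)) hsmul]
    rw [aeval_mk_X, Ideal.Quotient.eq_zero_iff_mem.2 hf, mul_zero]
  · intro f hf
    set J := homIdeal W I ⊔ Ideal.span {X 0 - C c}
    have h0 : Ideal.Quotient.mk J (X 0) = algebraMap K _ c :=
      Ideal.Quotient.eq.2 (Ideal.mem_sup_right (Ideal.mem_span_singleton_self _))
    have h1 : aeval (fun i => Ideal.Quotient.mk J (X i)) (homogenize W f) = 0 := by
      rw [aeval_mk_X]
      exact Ideal.Quotient.eq_zero_iff_mem.2 (Ideal.mem_sup_left (Ideal.subset_span ⟨f, hf, rfl⟩))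
    rw [homogenize_eq_homogenizeAt,
      aeval_homogenizeAt W (weight_le_of_coeff_ne_zero W f) _
        (fun i : Fin n => (c ^ W i)⁻¹ • Ideal.Quotient.mk J (X i.succ)) (fun i => by
          rw [h0, ← map_pow, ← Algebra.smul_def, smul_smul, mul_inv_cancel₀ (pow_ne_zero _ hc),
            one_smul]),
      h0, ← map_pow, ← Algebra.smul_def] at h1
    exact (smul_eq_zero_iff_right (pow_ne_zero _ hc)).1 h1

variable {O : Set (Fin n →₀ ℕ)} {I : Ideal (MvPolynomial (Fin n) K)}
  {g : border O → MvPolynomial (Fin n) K} {W : Fin n → ℕ}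

theorem IsBorderBasis.nonempty_special_fiber_algEquiv (hg : IsBorderBasis O I g)
    (hO : IsLowerSet O) (hne : O.Nonempty) (hW : ∀ b, degreeForm W (g b) = monomial b.1 1) :
    Nonempty ((MvPolynomial (Fin (n + 1)) K ⧸ (homIdeal W I ⊔ Ideal.span {X 0})) ≃ₐ[K]
      (MvPolynomial (Fin n) K ⧸ borderTermIdeal K O)) := by
  refine nonempty_fiber_algEquiv _ _ _ 0 (by rw [map_zero, sub_zero]) (fun _ => 1)
    (fun _ => one_ne_zero) ?_ ?_
  · change homIdeal W I ≤ RingHom.ker (aeval _)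
    refine Ideal.span_le.2 ?_
    rintro _ ⟨f, hf, rfl⟩
    rw [SetLike.mem_coe, RingHom.mem_ker, aeval_homogenize_zero W f _
      (by rw [Fin.cons_zero, map_zero])]
    simp only [Fin.cons_succ, one_smul]
    rw [aeval_mk_X]
    exact Ideal.Quotient.eq_zero_iff_mem.2 (hg.degreeForm_mem hO hne hW hf)
  · change borderTermIdeal K O ≤ RingHom.ker (aeval _)
    refine Ideal.span_le.2 ?_
    rintro _ ⟨b, hb, rfl⟩
    set J := homIdeal W I ⊔ Ideal.span {X 0}
    have h0 : Ideal.Quotient.mk J (X 0) = 0 :=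
      Ideal.Quotient.eq_zero_iff_mem.2 (Ideal.mem_sup_right (Ideal.mem_span_singleton_self _))
    have h1 := aeval_homogenize_zero W (g ⟨b, hb⟩) (fun i => Ideal.Quotient.mk J (X i)) h0
    have hmem : homogenize W (g ⟨b, hb⟩) ∈ J :=
      Ideal.mem_sup_left (Ideal.subset_span ⟨_, (hg.1 ⟨b, hb⟩).1, rfl⟩)
    rw [aeval_mk_X, Ideal.Quotient.eq_zero_iff_mem.2 hmem, hW] at h1
    rw [SetLike.mem_coe, RingHom.mem_ker]
    simp only [inv_one, one_smul]
    exact h1.symm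

end Fibers

end BorderDeform

open BorderDeform MvPolynomial in
theorem proposition2p2 {K : Type*} [Field K] {n : ℕ} (I : Ideal (MvPolynomial (Fin n) K))
    (hI : IsZeroDimensional I) (σ : MonomialOrder (Fin n))
    (g : border (orderIdealOf σ I) → MvPolynomial (Fin n) K)
    (hg : IsBorderBasis (orderIdealOf σ I) I g) :
    (∃ W : Fin n → ℕ, (∀ i, 0 < W i) ∧
      (∀ b, degreeForm W (g b) = monomial b.1 1) ∧ IsMacaulayBasis W I (Set.range g)) ∧
    I = Ideal.span (Set.range g) ∧
    ∀ W : Fin n → ℕ, (∀ i, 0 < W i) →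
      (∀ b, degreeForm W (g b) = monomial b.1 1) → IsMacaulayBasis W I (Set.range g) →
      homIdeal W I = Ideal.span (Set.range fun b => homogenize W (g b)) ∧
      IsGradedFree (familyMap (homIdeal W I)) (quotientPart (extWeight W) (homIdeal W I)) ∧
      (familyMap (homIdeal W I)).toRingHom.Flat ∧
      (∀ c : K, c ≠ 0 → Nonempty
        ((MvPolynomial (Fin (n + 1)) K ⧸ (homIdeal W I ⊔ Ideal.span {X 0 - C c})) ≃ₐ[K]
          (MvPolynomial (Fin n) K ⧸ I))) ∧
      Nonempty
        ((MvPolynomial (Fin (n + 1)) K ⧸ (homIdeal W I ⊔ Ideal.span {X 0})) ≃ₐ[K]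
          (MvPolynomial (Fin n) K ⧸ borderTermIdeal K (orderIdealOf σ I))) := by
  have hO := isLowerSet_orderIdealOf σ I
  have hne := nonempty_of_isCompl hI.1 hg.2
  have := hI.2
  obtain ⟨W, hWpos, hW⟩ := hg.1.exists_weight (finite_of_disjoint hg.2.disjoint)
  refine ⟨⟨W, hWpos, hW, hg.isMacaulayBasis hO hne hW⟩, hg.eq_span hO hne hW, ?_⟩
  intro W _ hW _
  have hfree := hg.isGradedFree hO hne hW
  exact ⟨hg.homIdeal_eq_span hO hne hW, hfree, hfree.flat,
    fun c hc => nonempty_general_fiber_algEquiv W I hc,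
    hg.nonempty_special_fiber_algEquiv hO hne hW⟩
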